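/- Let $G$ be a compact connected Lie group, let $m$ be its normalised Haar measure, and let $\widehat G$ be the unitary dual of $G$, that is, the set of equivalence classes, under unitary equivalence, of irreducible strongly continuous unitary representations of $G$ on separable complex Hilbert spaces; each class is identified with a representative $\pi : G \to \mathcal U(V_\pi)$, whose dimension $d_\pi = \dim V_\pi$ is finite because $G$ is compact. For a Borel probability measure $\mu$ on $G$ put $$\widehat\mu(\pi) = \int_G \pi(\sigma^{-1})\,\mu(d\sigma), \qquad |||T||| = \operatorname{tr}(TT^*)^{1/2}.$$ Then $\mu$ has an $L^2$-density, i.e. there is a real function $f \in L^2(G,m)$ with $\mu(A) = \int_A f\,dm$ for all Borel sets $A \subseteq G$, if and only if $$\sum_{\pi \in \widehat G} d_\pi\, |||\widehat\mu(\pi)|||^2 < \infty .$$ In this case the density $f$ satisfies $$f(\sigma) = \sum_{\pi \in \widehat G} d_\pi \operatorname{tr}\bigl(\widehat\mu(\pi)\pi(\sigma)\bigr) \quad \text{for } m\text{-almost every } \sigma \in G,$$ where the series converges unconditionally in $L^2(G,m)$ and its sum is understood as the $L^2$-limit. -/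

import Mathlib

open MeasureTheory Filter Topology
open scoped Manifold ContDiff

/-- An irreducible unitary representation of a topological group `G`: a strongly continuous
homomorphism from `G` to the group of unitary operators on a non-zero separable complex Hilbert
space `V` that has no invariant closed subspace other than `0` and `V`.
Every separable Hilbert space is isometric to one in `Type`, so taking `V : Type` loses no
representation up to unitary equivalence. -/
structure UnitaryIrrep (G : Type*) [Group G] [TopologicalSpace G] where
  V : Type
  [normedAddCommGroup : NormedAddCommGroup V]
  [innerProductSpace : InnerProductSpace ℂ V]
  [completeSpace : CompleteSpace V]
  [separableSpace : TopologicalSpace.SeparableSpace V]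
  [nontrivial : Nontrivial V]
  toHom : G →* unitary (V →L[ℂ] V)
  strongly_continuous : ∀ v : V, Continuous fun g : G => (toHom g : V →L[ℂ] V) v
  irreducible : ∀ W : Submodule ℂ V, IsClosed (W : Set V) →
    (∀ g : G, ∀ w ∈ W, (toHom g : V →L[ℂ] V) w ∈ W) → W = ⊥ ∨ W = ⊤

attribute [instance] UnitaryIrrep.normedAddCommGroup UnitaryIrrep.innerProductSpace
  UnitaryIrrep.completeSpace UnitaryIrrep.separableSpace UnitaryIrrep.nontrivial

namespace UnitaryIrrep

/-- The operator `π(g)` on the space of `π`. -/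
noncomputable def op {G : Type*} [Group G] [TopologicalSpace G] (π : UnitaryIrrep G) (g : G) :
    π.V →L[ℂ] π.V :=
  (π.toHom g : π.V →L[ℂ] π.V)

/-- Unitary equivalence: a unitary isomorphism of the spaces conjugates one representation into
the other. -/
def Equivalent {G : Type*} [Group G] [TopologicalSpace G] (π ρ : UnitaryIrrep G) : Prop :=
  ∃ U : π.V ≃ₗᵢ[ℂ] ρ.V, ∀ (g : G) (v : π.V), U (π.op g v) = ρ.op g (U v)

/-- Unitary equivalence is an equivalence relation. -/
instance setoid (G : Type*) [Group G] [TopologicalSpace G] : Setoid (UnitaryIrrep G) where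
  r := Equivalent
  iseqv :=
    { refl := fun π => ⟨LinearIsometryEquiv.refl ℂ π.V, fun _ _ => rfl⟩
      symm := by
        rintro π ρ ⟨U, hU⟩
        refine ⟨U.symm, fun g v => ?_⟩
        apply U.injective
        rw [hU, U.apply_symm_apply, U.apply_symm_apply]
      trans := by
        rintro π ρ τ ⟨U, hU⟩ ⟨W, hW⟩
        refine ⟨U.trans W, fun g v => ?_⟩
        rw [LinearIsometryEquiv.trans_apply, LinearIsometryEquiv.trans_apply, hU, hW] }

/-- The dimension `d_π` of the space of `π` (finite for compact `G`). -/
noncomputable def dim {G : Type*} [Group G] [TopologicalSpace G] (π : UnitaryIrrep G) : ℕ :=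
  Module.finrank ℂ π.V

end UnitaryIrrep

/-- The unitary dual of `G`: unitary equivalence classes of irreducible unitary
representations. -/
def UnitaryDual (G : Type*) [Group G] [TopologicalSpace G] : Type _ :=
  Quotient (UnitaryIrrep.setoid G)

/-- A representative of an equivalence class. The quantities below that enter the series
(dimension, Hilbert-Schmidt norm and trace) do not depend on the choice made here. -/
noncomputable def UnitaryDual.rep {G : Type*} [Group G] [TopologicalSpace G]
    (x : UnitaryDual G) : UnitaryIrrep G :=
  Quotient.out x

/-- The trace of an operator on a finite-dimensional space. -/
noncomputable def opTrace {V : Type*} [NormedAddCommGroup V] [InnerProductSpace ℂ V]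
    (T : V →L[ℂ] V) : ℂ :=
  LinearMap.trace ℂ V (T : V →ₗ[ℂ] V)

/-- The Hilbert-Schmidt norm `tr(T T*)^(1/2)` of an operator on a finite-dimensional Hilbert
space (there `tr(T T*)` is real and non-negative). -/
noncomputable def hsNorm {V : Type*} [NormedAddCommGroup V] [InnerProductSpace ℂ V]
    [CompleteSpace V] (T : V →L[ℂ] V) : ℝ :=
  Real.sqrt (opTrace (T ∘L ContinuousLinearMap.adjoint T)).re

/-- The Fourier transform of the measure `μ` at `π`: the integral of `π(σ⁻¹)` in `σ` with respect
to `μ`. -/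
noncomputable def measureFourier {G : Type*} [Group G] [TopologicalSpace G] [MeasurableSpace G]
    (μ : Measure G) (π : UnitaryIrrep G) : π.V →L[ℂ] π.V :=
  ∫ σ, π.op σ⁻¹ ∂μ

/-- The real function `f` is an `L²`-density of `μ` with respect to `m`: it is integrable and
square integrable, and `μ(A)` is the integral of `f` over `A` for every measurable `A`. -/
def IsL2Density {G : Type*} [MeasurableSpace G] (μ m : Measure G) (f : G → ℝ) : Prop :=
  Integrable f m ∧ MemLp f 2 m ∧
    ∀ A : Set G, MeasurableSet A → μ.real A = ∫ σ in A, f σ ∂m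

/-- The series of functions `F i` converges (unconditionally) in `L²(m)` to `g`. -/
def HasL2Sum {G ι : Type*} [MeasurableSpace G] (m : Measure G) (F : ι → G → ℂ) (g : G → ℂ) :
    Prop :=
  (∀ i, MemLp (F i) 2 m) ∧ MemLp g 2 m ∧
    Tendsto (fun s : Finset ι => eLpNorm (fun σ => g σ - ∑ i ∈ s, F i σ) 2 m) atTop (𝓝 0)

/-! The functions √d_π ⟪e_i, π(·)e_j⟫, over all classes and index pairs, form a Hilbert basis of
L²(m) (`coefBasis`). Integrating their conjugates against μ gives, up to transposing indices, √d_π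
times the matrix entries of the Fourier transform of μ at π. Over one class, the squares of these
numbers sum to the term of the numerical series, and the corresponding block of the basis expansion
is the term of the function series. A density has exactly these numbers as coordinates, so Bessel
gives necessity and the basis expansion gives the formula. Conversely, square summability yields g
in L² with these coordinates; pairing with g and integrating against μ then agree on matrix
coefficients, hence on all continuous functions, and Re g is a density.

Orthonormality is Schur's lemma. Completeness is Peter-Weyl (`coefClosure_eq_top`): averaging a rank
one operator over an orbit gives a compact self-adjoint intertwiner, whose eigenspaces supply enough
finite-dimensional invariant subspaces. Coefficients of the regular representation are therefore
uniform limits of irreducible ones, and a functional killing them all must vanish. -/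

open scoped InnerProductSpace
open InnerProductSpace (rankOne)

set_option linter.unusedSectionVars false

/-- A unitary representation, given by inner product preserving operators. -/
structure IsUnitaryRep {G H : Type*} [Group G] [TopologicalSpace G] [NormedAddCommGroup H]
    [InnerProductSpace ℂ H] (ρ : G →* (H →L[ℂ] H)) : Prop where
  inner_map : ∀ g x y, ⟪ρ g x, ρ g y⟫_ℂ = ⟪x, y⟫_ℂ
  continuous_apply : ∀ v, Continuous fun g => ρ g v

namespace IsUnitaryRep

/-! ### Invariant subspaces of unitary representations -/

section Algebra

variable {G H : Type*} [Group G] [TopologicalSpace G] [NormedAddCommGroup H]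
  [InnerProductSpace ℂ H] {ρ : G →* (H →L[ℂ] H)}

theorem apply_inv_apply (ρ : G →* (H →L[ℂ] H)) (g : G) (x : H) : ρ g (ρ g⁻¹ x) = x := by
  rw [← mul_apply_eq_comp, ← map_mul, mul_inv_cancel, map_one,
    one_apply_eq_self]

theorem inner_inv (hρ : IsUnitaryRep ρ) (g : G) (x y : H) : ⟪ρ g⁻¹ x, y⟫_ℂ = ⟪x, ρ g y⟫_ℂ := by
  rw [← hρ.inner_map g, apply_inv_apply]

theorem inner_inv_right (hρ : IsUnitaryRep ρ) (g : G) (x y : H) :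
    ⟪x, ρ g⁻¹ y⟫_ℂ = ⟪ρ g x, y⟫_ℂ := by
  rw [← hρ.inner_map g, apply_inv_apply]

theorem norm_map (hρ : IsUnitaryRep ρ) (g : G) (x : H) : ‖ρ g x‖ = ‖x‖ := by
  have := congrArg RCLike.re (hρ.inner_map g x x)
  rw [inner_self_eq_norm_sq, inner_self_eq_norm_sq] at this
  exact (pow_left_inj₀ (norm_nonneg _) (norm_nonneg _) two_ne_zero).1 this

theorem orthogonal_invariant (hρ : IsUnitaryRep ρ) {W : Submodule ℂ H}
    (hW : ∀ g, ∀ w ∈ W, ρ g w ∈ W) (g : G) : ∀ w ∈ Wᗮ, ρ g w ∈ Wᗮ := by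
  intro w hw
  rw [Submodule.mem_orthogonal] at hw ⊢
  intro u hu
  rw [← hρ.inner_inv]
  exact hw _ (hW _ _ hu)

theorem mem_unitary [CompleteSpace H] (hρ : IsUnitaryRep ρ) (g : G) :
    ρ g ∈ unitary (H →L[ℂ] H) := by
  have h : star (ρ g) = ρ g⁻¹ := by
    rw [ContinuousLinearMap.star_eq_adjoint]
    symm
    rw [ContinuousLinearMap.eq_adjoint_iff]
    exact fun x y => hρ.inner_inv g x y
  rw [Unitary.mem_iff, h, ← map_mul, ← map_mul]
  simp

/-- A minimal non-zero finite-dimensional invariant subspace. -/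
structure IsMinimalInvariant (ρ : G →* (H →L[ℂ] H)) (W : Submodule ℂ H) : Prop where
  finiteDimensional : FiniteDimensional ℂ W
  invariant : ∀ g, ∀ w ∈ W, ρ g w ∈ W
  ne_bot : W ≠ ⊥
  minimal : ∀ W' ≤ W, (∀ g, ∀ w ∈ W', ρ g w ∈ W') → W' = ⊥ ∨ W' = W

/-- Complete reducibility, by induction on dimension: a non-minimal W splits into a proper invariant
W₁ and its orthogonal complement in W, again invariant. -/
theorem le_iSup_isMinimalInvariant (hρ : IsUnitaryRep ρ) (W : Submodule ℂ H)
    (hfin : FiniteDimensional ℂ W) (hW : ∀ g, ∀ w ∈ W, ρ g w ∈ W) :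
    W ≤ ⨆ (W' : Submodule ℂ H) (_ : IsMinimalInvariant ρ W'), W' := by
  induction hn : Module.finrank ℂ W using Nat.strong_induction_on generalizing W with
  | _ n ih =>
    by_cases hbot : W = ⊥
    · simp [hbot]
    by_cases hmin : ∀ W' ≤ W, (∀ g, ∀ w ∈ W', ρ g w ∈ W') → W' = ⊥ ∨ W' = W
    · exact le_iSup₂_of_le W ⟨hfin, hW, hbot, hmin⟩ le_rfl
    push Not at hmin
    obtain ⟨W₁, hle, hinv, hne, hne'⟩ := hmin
    have hlt : W₁ < W := lt_of_le_of_ne hle hne'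
    have hfin₁ : FiniteDimensional ℂ W₁ := Submodule.finiteDimensional_of_le hle
    have hsup : W₁ ⊔ W₁ᗮ ⊓ W = W := Submodule.sup_orthogonal_inf_of_hasOrthogonalProjection hle
    have hlt' : W₁ᗮ ⊓ W < W := by
      refine lt_of_le_of_ne inf_le_right fun h => hne ?_
      rw [eq_bot_iff]
      intro x hx
      have : x ∈ W₁ᗮ ⊓ W := h.symm ▸ hle hx
      simpa using (Submodule.mem_orthogonal _ _).1 this.1 x hx
    rw [← hsup]
    refine sup_le ?_ ?_
    · exact ih _ (hn ▸ Submodule.finrank_lt_finrank_of_lt hlt) W₁ hfin₁ hinv rfl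
    · exact ih _ (hn ▸ Submodule.finrank_lt_finrank_of_lt hlt') _
        (Submodule.finiteDimensional_of_le inf_le_right)
        (fun g w hw => ⟨hρ.orthogonal_invariant hinv g w hw.1, hW g w hw.2⟩) rfl

/-- The irreducible representation carried by a minimal invariant subspace. -/
theorem IsMinimalInvariant.exists_unitaryIrrep (hρ : IsUnitaryRep ρ) {W : Submodule ℂ H}
    (hW : IsMinimalInvariant ρ W) :
    ∃ (π : UnitaryIrrep G) (U : W ≃ₗᵢ[ℂ] π.V), ∀ g (w : W),
      π.op g (U w) = U ⟨ρ g w, hW.invariant g w w.2⟩ := by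
  have := hW.finiteDimensional
  -- The space of a `UnitaryIrrep` lies in `Type`, while `W` may lie in any universe, so the action
  -- is transported to coordinates.
  let U : W ≃ₗᵢ[ℂ] EuclideanSpace ℂ (Fin (Module.finrank ℂ W)) := (stdOrthonormalBasis ℂ W).repr
  let T : G →* (EuclideanSpace ℂ (Fin (Module.finrank ℂ W)) →L[ℂ]
      EuclideanSpace ℂ (Fin (Module.finrank ℂ W))) :=
    { toFun := fun g => (U : W →L[ℂ] _) ∘L ((ρ g).restrict (hW.invariant g)) ∘L
        (U.symm : _ →L[ℂ] W)
      map_one' := by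
        ext1 x
        change U ⟨(ρ 1) (U.symm x), _⟩ = x
        simp
      map_mul' := fun a b => by
        ext1 x
        change U ⟨(ρ (a * b)) (U.symm x), _⟩ = U ⟨ρ a (U.symm (U ⟨ρ b (U.symm x), _⟩) : W), _⟩
        simp }
  have hT : ∀ g x, T g x = U ⟨ρ g (U.symm x), hW.invariant g _ (U.symm x).2⟩ := fun g x => rfl
  have hTU : ∀ g (w : W), T g (U w) = U ⟨ρ g w, hW.invariant g w w.2⟩ := by
    intro g w
    rw [hT]
    simp
  have hTu : IsUnitaryRep T :=
    { inner_map := fun g x y => by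
        rw [hT, hT, U.inner_map_map, Submodule.coe_inner, hρ.inner_map, ← Submodule.coe_inner,
          U.symm.inner_map_map]
      continuous_apply := fun v => by
        simp only [hT]
        exact U.continuous.comp ((hρ.continuous_apply _).subtype_mk _) }
  have hnt : Nontrivial W := Submodule.nontrivial_iff_ne_bot.2 hW.ne_bot
  have hnt' : Nontrivial (EuclideanSpace ℂ (Fin (Module.finrank ℂ W))) :=
    U.symm.toEquiv.nontrivial
  refine ⟨{ V := EuclideanSpace ℂ (Fin (Module.finrank ℂ W))
            toHom := T.codRestrict (unitary _) hTu.mem_unitary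
            strongly_continuous := hTu.continuous_apply
            irreducible := ?_ }, U, ?_⟩
  · intro K _ hK
    change ∀ g, ∀ w ∈ K, T g w ∈ K at hK
    let K' : Submodule ℂ H := (K.comap (U.toLinearEquiv : W →ₗ[ℂ] _)).map W.subtype
    have hmem : ∀ w : W, (w : H) ∈ K' ↔ U w ∈ K := by
      intro w
      constructor
      · rintro ⟨w', hw', h⟩
        rw [← Subtype.ext h]
        exact hw'
      · intro h
        exact ⟨w, h, rfl⟩
    have hle : K' ≤ W := Submodule.map_subtype_le _ _
    rcases hW.minimal K' hle (fun g w hw => by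
      have h1 := (hmem ⟨w, hle hw⟩).1 hw
      have h2 := hK g _ h1
      rw [hT] at h2
      simp only [LinearIsometryEquiv.symm_apply_apply] at h2
      exact (hmem _).2 h2) with h | h
    · left
      rw [eq_bot_iff]
      intro x hx
      have : ((U.symm x : W) : H) ∈ K' := (hmem _).2 (by simpa using hx)
      rw [h, Submodule.mem_bot, Submodule.coe_eq_zero] at this
      simpa using this
    · right
      rw [eq_top_iff]
      intro x _
      have : ((U.symm x : W) : H) ∈ K' := h.ge (U.symm x).2
      simpa using (hmem _).1 this
  · exact hTU

end Algebra

/-! ### Orbit averages and finite-dimensional invariant subspaces -/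

section Averaging

variable {G H : Type*} [Group G] [TopologicalSpace G] [NormedAddCommGroup H]
  [InnerProductSpace ℂ H] {ρ : G →* (H →L[ℂ] H)}
  [IsTopologicalGroup G] [CompactSpace G] [SecondCountableTopology G] [MeasurableSpace G]
  [BorelSpace G] (m : Measure G) [m.IsHaarMeasure] [IsProbabilityMeasure m]

/-- The average of the rank one operators on the orbit of `v`. -/
noncomputable def orbitAverage (ρ : G →* (H →L[ℂ] H)) (v : H) : H →L[ℂ] H :=
  ∫ g, rankOne ℂ (ρ g v) (ρ g v) ∂m

theorem _root_.Continuous.integrable_of_compactSpace {X E : Type*} [TopologicalSpace X]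
    [CompactSpace X] [SecondCountableTopology X] [MeasurableSpace X] [BorelSpace X]
    [NormedAddCommGroup E] {f : X → E} (hf : Continuous f) (ν : Measure X) [IsFiniteMeasure ν] :
    Integrable f ν := by
  refine hf.integrable_of_hasCompactSupport ?_
  exact HasCompactSupport.of_compactSpace f

theorem continuous_rankOne (hρ : IsUnitaryRep ρ) (v : H) :
    Continuous fun g => rankOne ℂ (ρ g v) (ρ g v) := by
  have := hρ.continuous_apply v
  exact ((ContinuousLinearMap.smulRightL ℂ H H).continuous.comp
    ((innerSL ℂ (E := H)).continuous.comp this)).clm_apply this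

variable [CompleteSpace H]

theorem orbitAverage_apply (hρ : IsUnitaryRep ρ) (v x : H) :
    orbitAverage m ρ v x = ∫ g, ⟪ρ g v, x⟫_ℂ • ρ g v ∂m := by
  rw [orbitAverage, ContinuousLinearMap.integral_apply
    ((hρ.continuous_rankOne v).integrable_of_compactSpace m)]
  rfl

theorem inner_orbitAverage (hρ : IsUnitaryRep ρ) (v x y : H) :
    ⟪x, orbitAverage m ρ v y⟫_ℂ = ∫ g, ⟪ρ g v, y⟫_ℂ * ⟪x, ρ g v⟫_ℂ ∂m := by
  have hc := hρ.continuous_apply v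
  rw [orbitAverage_apply m hρ, ← integral_inner
    (Continuous.integrable_of_compactSpace (by fun_prop) m)]
  simp only [inner_smul_right]

theorem isSymmetric_orbitAverage (hρ : IsUnitaryRep ρ) (v : H) :
    (orbitAverage m ρ v : H →ₗ[ℂ] H).IsSymmetric := by
  intro x y
  rw [← inner_conj_symm]
  simp only [ContinuousLinearMap.coe_coe]
  rw [inner_orbitAverage m hρ, inner_orbitAverage m hρ, ← integral_conj]
  simp only [map_mul, inner_conj_symm]
  simp only [mul_comm]

/-- Compact operators form a closed convex set, so it contains the mean of the rank one operators
under a probability measure. -/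
theorem isCompactOperator_orbitAverage (hρ : IsUnitaryRep ρ) (v : H) :
    IsCompactOperator (orbitAverage m ρ v) := by
  have hconv : Convex ℝ {f : H →L[ℂ] H | IsCompactOperator f} :=
    ((compactOperator (RingHom.id ℂ) H H).restrictScalars ℝ).convex
  refine hconv.integral_mem isClosed_setOfPred_isCompactOperator (.of_forall fun g => ?_)
    ((hρ.continuous_rankOne v).integrable_of_compactSpace m)
  rw [Set.mem_ofPred_eq, InnerProductSpace.rankOne_def']
  have hid : IsCompactOperator (id : ℂ → ℂ) :=
    (isCompactOperator_id_iff_finiteDimensional (𝕜 := ℂ)).2 inferInstance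
  exact (hid.comp_clm (innerSL ℂ (ρ g v))).clm_comp (.toSpanSingleton ℂ (ρ g v))

theorem orbitAverage_commute (hρ : IsUnitaryRep ρ) (v x : H) (h : G) :
    orbitAverage m ρ v (ρ h x) = ρ h (orbitAverage m ρ v x) := by
  have hc := hρ.continuous_apply v
  rw [orbitAverage_apply m hρ, orbitAverage_apply m hρ, ← ContinuousLinearMap.integral_comp_comm _
    (Continuous.integrable_of_compactSpace (by fun_prop) m), ← integral_mul_left_eq_self _ h]
  simp only [map_mul, mul_apply_eq_comp, hρ.inner_map, map_smul]

theorem _root_.Continuous.eq_zero_of_integral_eq_zero [IsFiniteMeasure m] {f : G → ℝ}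
    (hf : Continuous f)
    (h0 : ∀ g, 0 ≤ f g) (h : ∫ g, f g ∂m = 0) : ∀ g, f g = 0 := by
  rw [integral_eq_zero_iff_of_nonneg h0 (hf.integrable_of_compactSpace m)] at h
  exact fun g => congrFun ((hf.ae_eq_iff_eq m continuous_const).1 h) g

/-- Pairing the average at x with x gives ∫ |⟪ρ(g)v, x⟫|² dm; the continuous integrand vanishes
everywhere, in particular at g = 1. -/
theorem inner_eq_zero_of_orbitAverage_eq_zero (hρ : IsUnitaryRep ρ) {v x : H}
    (h : orbitAverage m ρ v x = 0) : ⟪v, x⟫_ℂ = 0 := by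
  have h1 := inner_orbitAverage m hρ v x x
  have hc := hρ.continuous_apply v
  have h2 : ∀ g, ⟪ρ g v, x⟫_ℂ * ⟪x, ρ g v⟫_ℂ = ((‖⟪ρ g v, x⟫_ℂ‖ ^ 2 : ℝ) : ℂ) := by
    intro g
    rw [← inner_conj_symm x, RCLike.mul_conj]
    push_cast
    rfl
  rw [h, inner_zero_right] at h1
  simp only [h2] at h1
  rw [show ∫ g, ((‖⟪ρ g v, x⟫_ℂ‖ ^ 2 : ℝ) : ℂ) ∂m = ((∫ g, ‖⟪ρ g v, x⟫_ℂ‖ ^ 2 ∂m : ℝ) : ℂ) from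
    integral_ofReal] at h1
  have h3 := Continuous.eq_zero_of_integral_eq_zero m (f := fun g => ‖⟪ρ g v, x⟫_ℂ‖ ^ 2)
    (by fun_prop) (fun g => by positivity) (by exact_mod_cast h1.symm) 1
  simpa using h3

/-- The finite-dimensional invariant subspaces of a unitary representation of a compact group
are total. -/
theorem eq_zero_of_forall_orthogonal (m : Measure G) [m.IsHaarMeasure]
    [IsProbabilityMeasure m] (hρ : IsUnitaryRep ρ) {f : H}
    (hf : ∀ W : Submodule ℂ H, FiniteDimensional ℂ W → (∀ g, ∀ w ∈ W, ρ g w ∈ W) → f ∈ Wᗮ) :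
    f = 0 := by
  set S := orbitAverage m ρ f with hS
  have hsymm := isSymmetric_orbitAverage m hρ f
  have hcomp := isCompactOperator_orbitAverage m hρ f
  -- Eigenspaces for nonzero eigenvalues are finite-dimensional and invariant, hence orthogonal to
  -- f. By symmetry S f is orthogonal to these and to the kernel, so the spectral theorem gives S f
  -- = 0.
  have hSf : S f = 0 := by
    have : S f ∈ (⨆ μ, Module.End.eigenspace (S : Module.End ℂ H) μ)ᗮ := by
      rw [← Submodule.iInf_orthogonal, Submodule.mem_iInf]
      intro μ
      rw [Submodule.mem_orthogonal']
      intro u hu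
      have hu' : S u = μ • u := Module.End.mem_eigenspace_iff.1 hu
      rw [show ⟪S f, u⟫_ℂ = ⟪f, S u⟫_ℂ from hsymm f u, hu', inner_smul_right]
      by_cases hμ : μ = 0
      · simp [hμ]
      have hfin := ContinuousLinearMap.finite_dimensional_eigenspace hcomp μ hμ
      have := hf _ hfin (fun g w hw => by
        rw [Module.End.mem_eigenspace_iff] at hw ⊢
        change S w = μ • w at hw
        change S (ρ g w) = μ • ρ g w
        rw [hS, orbitAverage_commute m hρ, ← hS, hw, map_smul])
      rw [Submodule.mem_orthogonal'] at this
      rw [this u hu, mul_zero]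
    rwa [ContinuousLinearMap.orthogonalComplement_iSup_eigenspaces_eq_bot hcomp hsymm] at this
  simpa using inner_eq_zero_of_orbitAverage_eq_zero m hρ hSf

end Averaging

end IsUnitaryRep

namespace UnitaryIrrep

variable {G : Type*} [Group G] [TopologicalSpace G]

/-- The underlying homomorphism to bounded operators. -/
noncomputable def opHom (π : UnitaryIrrep G) : G →* (π.V →L[ℂ] π.V) :=
  (unitary _).subtype.comp π.toHom

@[simp] theorem opHom_apply (π : UnitaryIrrep G) (g : G) : π.opHom g = π.op g := rfl

theorem isUnitaryRep (π : UnitaryIrrep G) : IsUnitaryRep π.opHom where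
  inner_map g x y := by
    have h := Unitary.star_mul_self_of_mem (π.toHom g).2
    rw [← ContinuousLinearMap.adjoint_inner_right, ← ContinuousLinearMap.star_eq_adjoint,
      ← mul_apply_eq_comp]
    change ⟪x, (star (π.toHom g : π.V →L[ℂ] π.V) * (π.toHom g : π.V →L[ℂ] π.V)) y⟫_ℂ = _
    rw [h, one_apply_eq_self]
  continuous_apply := π.strongly_continuous

/-- Otherwise irreducibility leaves 0 as the only finite-dimensional invariant subspace, and every
vector is orthogonal to it, contradicting totality. -/
theorem finiteDimensional [IsTopologicalGroup G] [CompactSpace G] [SecondCountableTopology G]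
    [MeasurableSpace G] [BorelSpace G] (m : Measure G) [m.IsHaarMeasure] [IsProbabilityMeasure m]
    (π : UnitaryIrrep G) : FiniteDimensional ℂ π.V := by
  obtain ⟨f, hf⟩ := exists_ne (0 : π.V)
  by_contra hinf
  refine hf (IsUnitaryRep.eq_zero_of_forall_orthogonal m π.isUnitaryRep fun W hW hinv => ?_)
  rcases π.irreducible W W.closed_of_finiteDimensional hinv with h | h
  · simp [h]
  · subst h
    exact absurd (Module.Finite.equiv Submodule.topEquiv) hinf

end UnitaryIrrep

namespace UnitaryIrrep

/-! ### Schur's lemma -/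

section Schur

variable {G : Type*} [Group G] [TopologicalSpace G]

theorem op_mul (π : UnitaryIrrep G) (g h : G) (v : π.V) : π.op (g * h) v = π.op g (π.op h v) := by
  rw [← opHom_apply, map_mul, mul_apply_eq_comp]
  rfl

theorem inner_op_op (π : UnitaryIrrep G) (g : G) (x y : π.V) :
    ⟪π.op g x, π.op g y⟫_ℂ = ⟪x, y⟫_ℂ :=
  π.isUnitaryRep.inner_map g x y

theorem inner_op_inv (π : UnitaryIrrep G) (g : G) (x y : π.V) :
    ⟪π.op g⁻¹ x, y⟫_ℂ = ⟪x, π.op g y⟫_ℂ :=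
  π.isUnitaryRep.inner_inv g x y

theorem inner_op_inv_right (π : UnitaryIrrep G) (g : G) (x y : π.V) :
    ⟪x, π.op g⁻¹ y⟫_ℂ = ⟪π.op g x, y⟫_ℂ :=
  π.isUnitaryRep.inner_inv_right g x y

theorem continuous_op_apply (π : UnitaryIrrep G) (v : π.V) : Continuous fun g => π.op g v :=
  π.strongly_continuous v

/-- Schur's lemma for self-intertwiners. -/
theorem exists_eq_smul_of_commute (π : UnitaryIrrep G) [FiniteDimensional ℂ π.V]
    (T : π.V →L[ℂ] π.V) (hT : ∀ g v, T (π.op g v) = π.op g (T v)) : ∃ c : ℂ, ∀ v, T v = c • v := by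
  obtain ⟨c, hc⟩ := Module.End.exists_eigenvalue (T : Module.End ℂ π.V)
  refine ⟨c, fun v => ?_⟩
  rcases π.irreducible (Module.End.eigenspace (T : Module.End ℂ π.V) c)
    (Submodule.closed_of_finiteDimensional _) (fun g w hw => by
      rw [Module.End.mem_eigenspace_iff] at hw ⊢
      change T w = c • w at hw
      change T (π.op g w) = c • π.op g w
      rw [hT, hw, map_smul]) with h | h
  · exact absurd h hc
  · have : v ∈ Module.End.eigenspace (T : Module.End ℂ π.V) c := h ▸ Submodule.mem_top
    exact Module.End.mem_eigenspace_iff.1 this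

/-- Schur's lemma for intertwiners of inequivalent representations. -/
theorem eq_zero_of_not_equivalent {π ρ : UnitaryIrrep G} [FiniteDimensional ℂ π.V]
    [FiniteDimensional ℂ ρ.V] (hne : ¬ Equivalent π ρ)
    (T : π.V →L[ℂ] ρ.V) (hT : ∀ g v, T (π.op g v) = ρ.op g (T v)) : T = 0 := by
  by_contra hT0
  -- T*T is a self-intertwiner, hence a scalar c > 0 when T ≠ 0; then T/√c is an isometry, onto
  -- because its range is a nonzero invariant subspace.
  obtain ⟨c, hc⟩ := π.exists_eq_smul_of_commute (ContinuousLinearMap.adjoint T ∘L T) (by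
    intro g v
    refine ext_inner_left ℂ fun w => ?_
    rw [ContinuousLinearMap.comp_apply, ContinuousLinearMap.comp_apply,
      ContinuousLinearMap.adjoint_inner_right, hT, ← ρ.inner_op_inv, ← hT,
      ← ContinuousLinearMap.adjoint_inner_right, π.inner_op_inv])
  have hinner : ∀ v w, ⟪T v, T w⟫_ℂ = c * ⟪v, w⟫_ℂ := by
    intro v w
    rw [← ContinuousLinearMap.adjoint_inner_right, ← ContinuousLinearMap.comp_apply, hc,
      inner_smul_right]
  have hnorm : ∀ v, ‖T v‖ ^ 2 = c.re * ‖v‖ ^ 2 := by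
    intro v
    have := hinner v v
    rw [inner_self_eq_norm_sq_to_K, inner_self_eq_norm_sq_to_K] at this
    have h2 : ((‖T v‖ ^ 2 : ℝ) : ℂ) = c * ((‖v‖ ^ 2 : ℝ) : ℂ) := by
      push_cast
      exact this
    have h3 := congrArg Complex.re h2
    rwa [Complex.re_mul_ofReal, Complex.ofReal_re] at h3
  have hcpos : 0 < c.re := by
    obtain ⟨v, hv⟩ : ∃ v, T v ≠ 0 := by
      by_contra! h
      exact hT0 (ContinuousLinearMap.ext h)
    have h1 : 0 < ‖T v‖ ^ 2 := by positivity
    rw [hnorm v] at h1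
    exact pos_of_mul_pos_left h1 (by positivity)
  let s : ℂ := ((Real.sqrt c.re)⁻¹ : ℝ)
  have hs : s ≠ 0 := by
    simp only [s, ne_eq, Complex.ofReal_eq_zero, inv_eq_zero]
    exact (Real.sqrt_pos.2 hcpos).ne'
  let U₀ : π.V →ₗᵢ[ℂ] ρ.V :=
    { toLinearMap := ((s • T : π.V →L[ℂ] ρ.V) : π.V →ₗ[ℂ] ρ.V)
      norm_map' := fun v => by
        change ‖s • T v‖ = ‖v‖
        refine (pow_left_inj₀ (norm_nonneg _) (norm_nonneg _) two_ne_zero).1 ?_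
        rw [norm_smul, mul_pow, hnorm]
        simp only [s, Complex.norm_real, Real.norm_eq_abs, sq_abs, inv_pow]
        rw [Real.sq_sqrt hcpos.le, inv_mul_cancel_left₀ hcpos.ne'] }
  have hU₀ : ∀ v, U₀ v = s • T v := fun _ => rfl
  have hsurj : Function.Surjective U₀ := by
    rcases ρ.irreducible (LinearMap.range U₀.toLinearMap)
      (Submodule.closed_of_finiteDimensional _) (by
        rintro g _ ⟨v, rfl⟩
        refine ⟨π.op g v, ?_⟩
        change s • T (π.op g v) = ρ.op g (s • T v)
        rw [hT, map_smul]) with h | h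
    · exfalso
      apply hT0
      ext1 v
      have : U₀ v ∈ LinearMap.range U₀.toLinearMap := ⟨v, rfl⟩
      rw [h, Submodule.mem_bot, hU₀, smul_eq_zero] at this
      exact this.resolve_left hs
    · exact LinearMap.range_eq_top.1 h
  refine hne ⟨LinearIsometryEquiv.ofSurjective U₀ hsurj, fun g v => ?_⟩
  change s • T (π.op g v) = ρ.op g (s • T v)
  rw [hT, map_smul]

end Schur

/-! ### Schur's orthogonality relations -/

section Orthogonality

variable {G : Type*} [Group G] [TopologicalSpace G]
  [IsTopologicalGroup G] [CompactSpace G] [SecondCountableTopology G] [MeasurableSpace G]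
  [BorelSpace G] (m : Measure G) [m.IsHaarMeasure] [IsProbabilityMeasure m]

/-- The average of the rank one operator `|w⟩⟨v|` over two representations. -/
noncomputable def intertwiner (π ρ : UnitaryIrrep G) (w : ρ.V) (v : π.V) : π.V →L[ℂ] ρ.V :=
  ∫ g, rankOne ℂ (ρ.op g w) (π.op g v) ∂m

theorem continuous_rankOne_op (π ρ : UnitaryIrrep G) (w : ρ.V) (v : π.V) :
    Continuous fun g => rankOne ℂ (ρ.op g w) (π.op g v) :=
  ((ContinuousLinearMap.smulRightL ℂ π.V ρ.V).continuous.comp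
    ((innerSL ℂ (E := π.V)).continuous.comp (π.continuous_op_apply v))).clm_apply
      (ρ.continuous_op_apply w)

theorem intertwiner_apply (π ρ : UnitaryIrrep G) (w : ρ.V) (v x : π.V) :
    intertwiner m π ρ w v x = ∫ g, ⟪π.op g v, x⟫_ℂ • ρ.op g w ∂m := by
  rw [intertwiner, ContinuousLinearMap.integral_apply
    ((continuous_rankOne_op π ρ w v).integrable_of_compactSpace m)]
  rfl

theorem inner_intertwiner (π ρ : UnitaryIrrep G) (w w' : ρ.V) (v x : π.V) :
    ⟪w', intertwiner m π ρ w v x⟫_ℂ = ∫ g, ⟪π.op g v, x⟫_ℂ * ⟪w', ρ.op g w⟫_ℂ ∂m := by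
  have h1 := π.continuous_op_apply v
  have h2 := ρ.continuous_op_apply w
  rw [intertwiner_apply m, ← integral_inner
    (Continuous.integrable_of_compactSpace (by fun_prop) m)]
  simp only [inner_smul_right]

theorem intertwiner_op (π ρ : UnitaryIrrep G) (w : ρ.V) (v x : π.V) (h : G) :
    intertwiner m π ρ w v (π.op h x) = ρ.op h (intertwiner m π ρ w v x) := by
  have h1 := π.continuous_op_apply v
  have h2 := ρ.continuous_op_apply w
  rw [intertwiner_apply m, intertwiner_apply m, ← ContinuousLinearMap.integral_comp_comm _
    (Continuous.integrable_of_compactSpace (by fun_prop) m), ← integral_mul_left_eq_self _ h]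
  simp only [op_mul, inner_op_op, map_smul]

/-- Matrix coefficients of inequivalent irreducible representations are orthogonal. -/
theorem integral_inner_mul_inner_eq_zero {π ρ : UnitaryIrrep G} (hne : ¬ Equivalent π ρ)
    (w w' : ρ.V) (v v' : π.V) :
    ∫ g, ⟪π.op g v, v'⟫_ℂ * ⟪w', ρ.op g w⟫_ℂ ∂m = 0 := by
  have := π.finiteDimensional m
  have := ρ.finiteDimensional m
  rw [← inner_intertwiner m, eq_zero_of_not_equivalent hne _ fun g v => intertwiner_op m _ _ _ _ _ _]
  simp

/-- Schur's orthogonality relations. -/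
theorem integral_inner_mul_inner (π : UnitaryIrrep G) (w w' v v' : π.V) :
    ∫ g, ⟪π.op g v, v'⟫_ℂ * ⟪w', π.op g w⟫_ℂ ∂m = (π.dim : ℂ)⁻¹ * ⟪v, w⟫_ℂ * ⟪w', v'⟫_ℂ := by
  have := π.finiteDimensional m
  obtain ⟨c, hc⟩ := π.exists_eq_smul_of_commute (intertwiner m π π w v)
    fun g x => intertwiner_op m _ _ _ _ _ _
  rw [← inner_intertwiner m, hc, inner_smul_right]
  congr 1
  -- The scalar c is found by computing the trace of the averaged operator twice: as c times the
  -- dimension, and under the integral by Parseval.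
  let b := stdOrthonormalBasis ℂ π.V
  have h1 : ∑ i, ⟪b i, intertwiner m π π w v (b i)⟫_ℂ = (π.dim : ℂ) * c := by
    simp only [hc, inner_smul_right, inner_self_eq_norm_sq_to_K, b.norm_eq_one]
    simp [dim]
  have h2 : ∑ i, ⟪b i, intertwiner m π π w v (b i)⟫_ℂ = ⟪v, w⟫_ℂ := by
    have c1 := π.continuous_op_apply v
    have c2 := π.continuous_op_apply w
    simp only [inner_intertwiner m]
    rw [← integral_finsetSum _ fun i _ => Continuous.integrable_of_compactSpace (by fun_prop) m]
    simp only [b.sum_inner_mul_inner, inner_op_op, integral_const, probReal_univ, one_smul]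
  have hd : (π.dim : ℂ) ≠ 0 := by
    rw [Nat.cast_ne_zero]
    exact Module.finrank_pos.ne'
  rw [← h2, h1, inv_mul_cancel_left₀ hd]

end Orthogonality

end UnitaryIrrep

/-! ### Matrix coefficients as continuous functions -/

section Coefficients

variable {G H : Type*} [Group G] [TopologicalSpace G] [CompactSpace G]

/-- The matrix coefficient `g ↦ ⟪u, π(g) v⟫` of an irreducible representation. -/
noncomputable def UnitaryIrrep.coef (π : UnitaryIrrep G) (u v : π.V) : C(G, ℂ) where
  toFun g := ⟪u, π.op g v⟫_ℂ
  continuous_toFun := by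
    have := π.continuous_op_apply v
    fun_prop

@[simp] theorem UnitaryIrrep.coef_apply (π : UnitaryIrrep G) (u v : π.V) (g : G) :
    π.coef u v g = ⟪u, π.op g v⟫_ℂ := rfl

variable (G) in
/-- The uniform closure of the span of the matrix coefficients of irreducible representations. -/
noncomputable def coefClosure : Submodule ℂ C(G, ℂ) :=
  (Submodule.span ℂ {f | ∃ (x : UnitaryDual G) (u v : x.rep.V), f = x.rep.coef u v}
    ).topologicalClosure

theorem isClosed_coefClosure : IsClosed (coefClosure G : Set C(G, ℂ)) :=
  Submodule.isClosed_topologicalClosure _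

theorem UnitaryIrrep.coef_mem_coefClosure (π : UnitaryIrrep G) (u v : π.V) :
    π.coef u v ∈ coefClosure G := by
  obtain ⟨U, hU⟩ : UnitaryIrrep.Equivalent (UnitaryDual.rep (Quotient.mk _ π)) π :=
    Quotient.mk_out π
  refine Submodule.le_topologicalClosure _ (Submodule.subset_span
    ⟨Quotient.mk _ π, U.symm u, U.symm v, ?_⟩)
  ext g
  rw [coef_apply, coef_apply, ← U.inner_map_map, hU, U.apply_symm_apply, U.apply_symm_apply]

namespace IsUnitaryRep

variable [NormedAddCommGroup H] [InnerProductSpace ℂ H] {ρ : G →* (H →L[ℂ] H)}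

/-- The map sending `h` to the matrix coefficient `g ↦ ⟪u, ρ(g) h⟫`. -/
noncomputable def coefMap (hρ : IsUnitaryRep ρ) (u : H) : H →L[ℂ] C(G, ℂ) :=
  LinearMap.mkContinuous
    { toFun := fun h => ⟨fun g => ⟪u, ρ g h⟫_ℂ, by
        have := hρ.continuous_apply h
        fun_prop⟩
      map_add' := fun x y => by ext g; simp
      map_smul' := fun c x => by ext g; simp } ‖u‖ (by
    intro x
    rw [ContinuousMap.norm_le _ (by positivity)]
    intro g
    refine (norm_inner_le_norm _ _).trans ?_
    rw [hρ.norm_map])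

@[simp] theorem coefMap_apply (hρ : IsUnitaryRep ρ) (u h : H) (g : G) :
    hρ.coefMap u h g = ⟪u, ρ g h⟫_ℂ := rfl

/-- The admissible h form a closed subspace K. It contains every minimal invariant W, since there u
may be replaced by its projection to W. So the complement of K is orthogonal to all
finite-dimensional invariant subspaces, hence zero. -/
theorem coefMap_mem_coefClosure [IsTopologicalGroup G] [SecondCountableTopology G]
    [MeasurableSpace G] [BorelSpace G] [CompleteSpace H] (m : Measure G) [m.IsHaarMeasure]
    [IsProbabilityMeasure m] (hρ : IsUnitaryRep ρ) (u h : H) :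
    hρ.coefMap u h ∈ coefClosure G := by
  let K : Submodule ℂ H := (coefClosure G).comap (hρ.coefMap u : H →ₗ[ℂ] C(G, ℂ))
  have hKc : IsClosed (K : Set H) := isClosed_coefClosure.preimage (hρ.coefMap u).continuous
  have := hKc.completeSpace_coe
  have hmin : ∀ W, IsMinimalInvariant ρ W → W ≤ K := by
    intro W hW h hh
    have := hW.finiteDimensional
    obtain ⟨π, U, hU⟩ := hW.exists_unitaryIrrep hρ
    have : hρ.coefMap u h = π.coef (U (W.orthogonalProjectionOnto u)) (U ⟨h, hh⟩) := by
      ext g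
      rw [coefMap_apply, UnitaryIrrep.coef_apply, hU, U.inner_map_map,
        Submodule.inner_orthogonalProjectionOnto_eq_of_mem_right]
    change hρ.coefMap u h ∈ coefClosure G
    rw [this]
    exact π.coef_mem_coefClosure _ _
  have hK : K = ⊤ := by
    rw [← Submodule.orthogonal_eq_bot_iff, eq_bot_iff]
    intro f hf
    refine hρ.eq_zero_of_forall_orthogonal m fun W hfin hinv => ?_
    refine Submodule.orthogonal_le ?_ hf
    exact (hρ.le_iSup_isMinimalInvariant W hfin hinv).trans (iSup₂_le hmin)
  have : h ∈ K := hK ▸ Submodule.mem_top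
  exact this

end IsUnitaryRep

end Coefficients

/-! ### The regular representation and the Peter-Weyl theorem -/

section PeterWeyl

variable {G : Type*} [Group G] [TopologicalSpace G]
  [IsTopologicalGroup G] [CompactSpace G] [T2Space G] [SecondCountableTopology G]
  [MeasurableSpace G] [BorelSpace G] (m : Measure G) [m.IsHaarMeasure] [IsProbabilityMeasure m]

/-- The left regular representation on `L²(m)`. -/
noncomputable def leftRegular : G →* (Lp ℂ 2 m →L[ℂ] Lp ℂ 2 m) where
  toFun g := (Lp.compMeasurePreservingₗᵢ ℂ (g⁻¹ * ·)
    (measurePreserving_mul_left m g⁻¹)).toContinuousLinearMap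
  map_one' := by
    ext1 f
    change Lp.compMeasurePreserving (1⁻¹ * ·) _ f = f
    have : ((1 : G)⁻¹ * ·) = (id : G → G) := by ext; simp
    simp only [this]
    exact Lp.compMeasurePreserving_id_apply f
  map_mul' a b := by
    ext1 f
    change Lp.compMeasurePreserving ((a * b)⁻¹ * ·) _ f =
      Lp.compMeasurePreserving (a⁻¹ * ·) _ (Lp.compMeasurePreserving (b⁻¹ * ·) _ f)
    rw [← Lp.compMeasurePreserving_comp_apply]
    have : ((a * b)⁻¹ * ·) = (b⁻¹ * ·) ∘ (a⁻¹ * ·) := by ext; simp [mul_assoc]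
    simp only [this]

theorem leftRegular_apply (g : G) (f : Lp ℂ 2 m) :
    leftRegular m g f = Lp.compMeasurePreserving (g⁻¹ * ·) (measurePreserving_mul_left m g⁻¹) f :=
  rfl

theorem isUnitaryRep_leftRegular : IsUnitaryRep (leftRegular m) where
  inner_map g x y := (Lp.compMeasurePreservingₗᵢ ℂ (g⁻¹ * ·)
    (measurePreserving_mul_left m g⁻¹)).inner_map_map x y
  continuous_apply f := by
    simp only [leftRegular_apply]
    have hc : Continuous fun g : G => (⟨(g⁻¹ * ·), by fun_prop⟩ : C(G, G)) :=
      ContinuousMap.continuous_of_continuous_uncurry _ (by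
        change Continuous fun p : G × G => p.1⁻¹ * p.2
        fun_prop)
    exact continuous_const.compMeasurePreservingLp hc
      (fun g => measurePreserving_mul_left m g⁻¹) (by simp)

/-- The translates `x ↦ (g ↦ φ(g⁻¹ x))` of a continuous function. -/
noncomputable def invTranslate (φ : C(G, ℂ)) : C(G, C(G, ℂ)) :=
  ContinuousMap.curry ⟨fun p : G × G => φ (p.2⁻¹ * p.1), by fun_prop⟩

@[simp] theorem invTranslate_apply (φ : C(G, ℂ)) (x g : G) :
    invTranslate φ x g = φ (g⁻¹ * x) := rfl

/-- Written as a C(G)-valued integral, the coefficient lets a continuous functional pass under the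
integral sign. -/
theorem coefMap_toLp_eq_integral (u φ : C(G, ℂ)) :
    (isUnitaryRep_leftRegular m).coefMap (ContinuousMap.toLp 2 m ℂ u)
      (ContinuousMap.toLp 2 m ℂ φ) = ∫ x, star (u x) • invTranslate φ x ∂m := by
  ext g
  rw [ContinuousMap.integral_apply (Continuous.integrable_of_compactSpace (by fun_prop) m),
    IsUnitaryRep.coefMap_apply]
  have : leftRegular m g (ContinuousMap.toLp 2 m ℂ φ) =
      ContinuousMap.toLp 2 m ℂ (φ.comp ⟨(g⁻¹ * ·), by fun_prop⟩) := rfl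
  rw [this, ContinuousMap.inner_toLp]
  refine integral_congr_ae (.of_forall fun x => ?_)
  simp [mul_comm]

/-- **Peter-Weyl theorem**: matrix coefficients of irreducible representations span a uniformly
dense space of continuous functions. -/
theorem coefClosure_eq_top (m : Measure G) [m.IsHaarMeasure] [IsProbabilityMeasure m] :
    coefClosure G = ⊤ := by
  by_contra hne
  obtain ⟨φ₀, hφ₀⟩ : ∃ φ, φ ∉ coefClosure G := by
    by_contra! h
    exact hne (eq_top_iff.2 fun φ _ => h φ)
  have hclosed : IsClosed (coefClosure G : Set C(G, ℂ)) := isClosed_coefClosure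
  obtain ⟨ℓ, hℓ, hℓ₀⟩ : ∃ ℓ : C(G, ℂ) →L[ℂ] ℂ, (∀ f ∈ coefClosure G, ℓ f = 0) ∧ ℓ φ₀ ≠ 0 := by
    have h0 : (coefClosure G).mkQL φ₀ ≠ 0 := by
      simpa using hφ₀
    obtain ⟨r, -, hr⟩ := exists_dual_vector ℂ ((coefClosure G).mkQL φ₀) (norm_ne_zero_iff.2 h0)
    refine ⟨r ∘L (coefClosure G).mkQL, fun f hf => ?_, ?_⟩
    · have : (coefClosure G).mkQL f = 0 := by simpa using hf
      rw [ContinuousLinearMap.comp_apply, this, map_zero]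
    · rw [ContinuousLinearMap.comp_apply, hr]
      exact Complex.ofReal_ne_zero.2 (norm_ne_zero_iff.2 h0)
  -- The inversion makes the translate at 1 equal to φ₀. With u chosen from ℓ itself, ℓ of the
  -- regular coefficient of u and φ is ∫ |u|² dm, so u = 0 and ℓ φ₀ = u 1 = 0.
  let φ : C(G, ℂ) := φ₀.comp ⟨(·⁻¹), continuous_inv⟩
  let u : C(G, ℂ) := ⟨fun x => ℓ (invTranslate φ x), by fun_prop⟩
  have h1 := hℓ _ ((isUnitaryRep_leftRegular m).coefMap_mem_coefClosure m
    (ContinuousMap.toLp 2 m ℂ u) (ContinuousMap.toLp 2 m ℂ φ))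
  rw [coefMap_toLp_eq_integral, ← ContinuousLinearMap.integral_comp_comm _
    (Continuous.integrable_of_compactSpace (by fun_prop) m)] at h1
  have h2 : ∀ x, ℓ (star (u x) • invTranslate φ x) = ((‖u x‖ ^ 2 : ℝ) : ℂ) := by
    intro x
    rw [map_smul, smul_eq_mul]
    change star (u x) * u x = _
    rw [Complex.star_def, RCLike.conj_mul]
    push_cast
    rfl
  simp only [h2] at h1
  rw [show ∫ x, ((‖u x‖ ^ 2 : ℝ) : ℂ) ∂m = ((∫ x, ‖u x‖ ^ 2 ∂m : ℝ) : ℂ) from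
    integral_ofReal] at h1
  have h3 := Continuous.eq_zero_of_integral_eq_zero m (f := fun x => ‖u x‖ ^ 2)
    (by fun_prop) (fun g => by positivity) (by exact_mod_cast h1) 1
  have h4 : u 1 = 0 := by simpa using h3
  apply hℓ₀
  have : invTranslate φ 1 = φ₀ := by
    ext g
    simp [φ]
  rw [← this]
  exact h4

end PeterWeyl

/-! ### The Hilbert basis of normalised matrix coefficients -/

section HilbertBasis

variable {G : Type*} [Group G] [TopologicalSpace G]
  [IsTopologicalGroup G] [CompactSpace G] [T2Space G] [SecondCountableTopology G]
  [MeasurableSpace G] [BorelSpace G] (m : Measure G) [m.IsHaarMeasure] [IsProbabilityMeasure m]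

/-- An orthonormal basis of the space of an irreducible representation of a compact group. -/
noncomputable def UnitaryIrrep.onb (π : UnitaryIrrep G) : OrthonormalBasis (Fin π.dim) ℂ π.V :=
  haveI := π.finiteDimensional m
  stdOrthonormalBasis ℂ π.V

theorem UnitaryIrrep.dim_pos (m : Measure G) [m.IsHaarMeasure] [IsProbabilityMeasure m]
    (π : UnitaryIrrep G) : 0 < π.dim :=
  haveI := π.finiteDimensional m
  Module.finrank_pos

theorem UnitaryIrrep.coef_eq_sum (π : UnitaryIrrep G) (u v : π.V) :
    π.coef u v = ∑ i, ∑ j, (⟪u, π.onb m i⟫_ℂ * ⟪π.onb m j, v⟫_ℂ) •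
      π.coef (π.onb m i) (π.onb m j) := by
  ext g
  simp only [ContinuousMap.sum_apply, ContinuousMap.smul_apply, coef_apply, smul_eq_mul]
  rw [← (π.onb m).sum_inner_mul_inner]
  refine Finset.sum_congr rfl fun i _ => ?_
  conv_lhs => rw [← (π.onb m).sum_repr' v, map_sum, inner_sum, Finset.mul_sum]
  refine Finset.sum_congr rfl fun j _ => ?_
  rw [map_smul, inner_smul_right, mul_assoc]

variable (G) in
/-- The index set of the normalised matrix coefficients. -/
abbrev DualIndex : Type _ := Σ x : UnitaryDual G, Fin x.rep.dim × Fin x.rep.dim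

/-- The normalised matrix coefficients `√d ⟪e_i, π(g) e_j⟫`. -/
noncomputable def normCoef (p : DualIndex G) : C(G, ℂ) :=
  ((Real.sqrt p.1.rep.dim : ℝ) : ℂ) • p.1.rep.coef (p.1.rep.onb m p.2.1) (p.1.rep.onb m p.2.2)

theorem normCoef_apply (p : DualIndex G) (g : G) : normCoef m p g =
    ((Real.sqrt p.1.rep.dim : ℝ) : ℂ) * ⟪p.1.rep.onb m p.2.1, p.1.rep.op g (p.1.rep.onb m p.2.2)⟫_ℂ :=
  rfl

theorem ofReal_sqrt_mul_self (n : ℕ) :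
    ((Real.sqrt n : ℝ) : ℂ) * ((Real.sqrt n : ℝ) : ℂ) = n := by
  rw [← Complex.ofReal_mul, Real.mul_self_sqrt (Nat.cast_nonneg _), Complex.ofReal_natCast]

theorem coef_mem_of_forall_normCoef_mem (K : Submodule ℂ C(G, ℂ)) (hK : ∀ p, normCoef m p ∈ K)
    (x : UnitaryDual G) (u v : x.rep.V) : x.rep.coef u v ∈ K := by
  rw [x.rep.coef_eq_sum m]
  refine Submodule.sum_mem _ fun i _ => Submodule.sum_mem _ fun j _ => Submodule.smul_mem _ _ ?_
  have hd : ((Real.sqrt x.rep.dim : ℝ) : ℂ) ≠ 0 :=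
    Complex.ofReal_ne_zero.2 (Real.sqrt_pos.2 (Nat.cast_pos.2 (x.rep.dim_pos m))).ne'
  rw [← K.smul_mem_iff hd]
  exact hK ⟨x, i, j⟩

/-- Peter-Weyl as a test principle, used both for density in L² and for comparing functionals on
C(G). -/
theorem eq_top_of_forall_normCoef_mem (K : Submodule ℂ C(G, ℂ)) (hKc : IsClosed (K : Set C(G, ℂ)))
    (hK : ∀ p, normCoef m p ∈ K) : K = ⊤ := by
  rw [eq_top_iff, ← coefClosure_eq_top m]
  refine Submodule.topologicalClosure_minimal _ (Submodule.span_le.2 ?_) hKc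
  rintro _ ⟨x, u, v, rfl⟩
  exact coef_mem_of_forall_normCoef_mem m K hK x u v

theorem orthonormal_normCoef :
    Orthonormal ℂ fun p : DualIndex G => ContinuousMap.toLp 2 m ℂ (normCoef m p) := by
  classical
  rw [orthonormal_iff_ite]
  rintro ⟨x, i, j⟩ ⟨y, k, l⟩
  rw [ContinuousMap.inner_toLp]
  have h1 : ∀ g, normCoef m ⟨y, k, l⟩ g * (starRingEnd ℂ) (normCoef m ⟨x, i, j⟩ g) =
      (((Real.sqrt y.rep.dim : ℝ) : ℂ) * ((Real.sqrt x.rep.dim : ℝ) : ℂ)) *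
      (⟪x.rep.op g (x.rep.onb m j), x.rep.onb m i⟫_ℂ *
        ⟪y.rep.onb m k, y.rep.op g (y.rep.onb m l)⟫_ℂ) := by
    intro g
    rw [normCoef_apply, normCoef_apply, map_mul, Complex.conj_ofReal, inner_conj_symm]
    ring
  simp only [h1]
  rw [integral_const_mul]
  by_cases hxy : x = y
  · subst hxy
    rw [UnitaryIrrep.integral_inner_mul_inner, ofReal_sqrt_mul_self,
      orthonormal_iff_ite.1 (x.rep.onb m).orthonormal, orthonormal_iff_ite.1 (x.rep.onb m).orthonormal]
    have hd : (x.rep.dim : ℂ) ≠ 0 := Nat.cast_ne_zero.2 (x.rep.dim_pos m).ne'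
    rw [mul_assoc, mul_inv_cancel_left₀ hd]
    by_cases h1 : i = k <;> by_cases h2 : j = l <;> simp [h1, h2, Ne.symm]
  · rw [UnitaryIrrep.integral_inner_mul_inner_eq_zero m, mul_zero, if_neg]
    · exact fun h => hxy (congrArg Sigma.fst h)
    · exact fun h => hxy (Quotient.out_equiv_out.1 h)

theorem dense_span_normCoef : ⊤ ≤ (Submodule.span ℂ (Set.range fun p : DualIndex G =>
    ContinuousMap.toLp 2 m ℂ (normCoef m p))).topologicalClosure := by
  set L := (Submodule.span ℂ (Set.range fun p : DualIndex G =>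
    ContinuousMap.toLp 2 m ℂ (normCoef m p))).topologicalClosure with hL
  have hLc : IsClosed (L : Set (Lp ℂ 2 m)) := Submodule.isClosed_topologicalClosure _
  have h := eq_top_of_forall_normCoef_mem m
    (L.comap (ContinuousMap.toLp 2 m ℂ : C(G, ℂ) →L[ℂ] Lp ℂ 2 m).toLinearMap)
    (hLc.preimage (ContinuousMap.toLp 2 m ℂ : C(G, ℂ) →L[ℂ] Lp ℂ 2 m).continuous)
    (fun p => Submodule.le_topologicalClosure _ (Submodule.subset_span ⟨p, rfl⟩))
  intro f _
  refine hLc.closure_subset_iff.2 ?_ (ContinuousMap.toLp_denseRange ℂ m ℂ (p := 2) (by simp) f)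
  rintro _ ⟨φ, rfl⟩
  have : φ ∈ L.comap (ContinuousMap.toLp 2 m ℂ : C(G, ℂ) →L[ℂ] Lp ℂ 2 m).toLinearMap :=
    h ▸ Submodule.mem_top
  exact this

/-- The Hilbert basis of `L²(m)` given by the normalised matrix coefficients. -/
noncomputable def coefBasis : HilbertBasis (DualIndex G) ℂ (Lp ℂ 2 m) :=
  HilbertBasis.mk (orthonormal_normCoef m) (dense_span_normCoef m)

theorem coefBasis_apply (p : DualIndex G) :
    coefBasis m p = ContinuousMap.toLp 2 m ℂ (normCoef m p) := by
  rw [coefBasis, HilbertBasis.coe_mk]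

end HilbertBasis

/-! ### Fourier transform of a measure in coordinates -/

section FourierTransform

variable {G : Type*} [Group G] [TopologicalSpace G]
  [IsTopologicalGroup G] [CompactSpace G] [T2Space G] [SecondCountableTopology G]
  [MeasurableSpace G] [BorelSpace G] (m : Measure G) [m.IsHaarMeasure] [IsProbabilityMeasure m]
  (μ : Measure G) [IsFiniteMeasure μ]

/-- The integral of the conjugate of a normalised matrix coefficient. -/
noncomputable def fourierCoef (p : DualIndex G) : ℂ :=
  ∫ σ, star (normCoef m p σ) ∂μ

theorem inner_measureFourier (m : Measure G) [m.IsHaarMeasure] [IsProbabilityMeasure m]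
    (π : UnitaryIrrep G) (u v : π.V) :
    ⟪u, measureFourier μ π v⟫_ℂ = ∫ σ, ⟪π.op σ u, v⟫_ℂ ∂μ := by
  have := π.finiteDimensional m
  -- In finite dimension strong continuity is norm continuity, so the operator-valued Bochner
  -- integral exists.
  have hc : Continuous fun σ : G => π.op σ⁻¹ :=
    continuous_clm_apply.2 fun w => (π.continuous_op_apply w).comp continuous_inv
  have hcv : Continuous fun σ : G => π.op σ⁻¹ v := (π.continuous_op_apply v).comp continuous_inv
  rw [measureFourier, ContinuousLinearMap.integral_apply (hc.integrable_of_compactSpace μ),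
    ← integral_inner (hcv.integrable_of_compactSpace μ)]
  simp only [π.inner_op_inv_right]

/-- Conjugation transposes the two indices; hence the use of `Fintype.sum_prod_type_right` when
summing over a class. -/
theorem fourierCoef_eq (p : DualIndex G) : fourierCoef m μ p = ((Real.sqrt p.1.rep.dim : ℝ) : ℂ) *
    ⟪p.1.rep.onb m p.2.2, measureFourier μ p.1.rep (p.1.rep.onb m p.2.1)⟫_ℂ := by
  rw [inner_measureFourier μ m, fourierCoef, ← integral_const_mul]
  refine integral_congr_ae (.of_forall fun σ => ?_)
  simp only [normCoef_apply, Complex.star_def, map_mul, Complex.conj_ofReal, inner_conj_symm]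

theorem dim_mul_opTrace_eq_sum (x : UnitaryDual G) (σ : G) :
    (x.rep.dim : ℂ) * opTrace (measureFourier μ x.rep ∘L x.rep.op σ) =
      ∑ p, fourierCoef m μ ⟨x, p⟩ * normCoef m ⟨x, p⟩ σ := by
  rw [opTrace, LinearMap.trace_eq_sum_inner _ (x.rep.onb m), Fintype.sum_prod_type_right,
    Finset.mul_sum]
  refine Finset.sum_congr rfl fun i _ => ?_
  have h : ⟪x.rep.onb m i, (measureFourier μ x.rep ∘L x.rep.op σ) (x.rep.onb m i)⟫_ℂ =
      ∑ k, ⟪x.rep.onb m i, measureFourier μ x.rep (x.rep.onb m k)⟫_ℂ *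
        ⟪x.rep.onb m k, x.rep.op σ (x.rep.onb m i)⟫_ℂ := by
    conv_lhs => rw [ContinuousLinearMap.comp_apply,
      ← (x.rep.onb m).sum_repr' (x.rep.op σ (x.rep.onb m i)), map_sum, inner_sum]
    refine Finset.sum_congr rfl fun k _ => ?_
    rw [map_smul, inner_smul_right, mul_comm]
  refine (congrArg _ h).trans ?_
  rw [Finset.mul_sum]
  refine Finset.sum_congr rfl fun k _ => ?_
  rw [fourierCoef_eq, normCoef_apply, ← ofReal_sqrt_mul_self]
  ring

theorem hsNorm_sq {V ι : Type*} [NormedAddCommGroup V] [InnerProductSpace ℂ V] [CompleteSpace V]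
    [Fintype ι] (b : OrthonormalBasis ι ℂ V) (T : V →L[ℂ] V) :
    hsNorm T ^ 2 = ∑ i, ∑ k, ‖⟪b i, T (b k)⟫_ℂ‖ ^ 2 := by
  have h : opTrace (T ∘L ContinuousLinearMap.adjoint T) =
      ((∑ i, ∑ k, ‖⟪b i, T (b k)⟫_ℂ‖ ^ 2 : ℝ) : ℂ) := by
    rw [opTrace, LinearMap.trace_eq_sum_inner _ b, Complex.ofReal_sum]
    refine Finset.sum_congr rfl fun i _ => ?_
    have : ⟪b i, (T ∘L ContinuousLinearMap.adjoint T) (b i)⟫_ℂ =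
        ((‖ContinuousLinearMap.adjoint T (b i)‖ ^ 2 : ℝ) : ℂ) := by
      rw [ContinuousLinearMap.comp_apply, ← ContinuousLinearMap.adjoint_inner_left,
        inner_self_eq_norm_sq_to_K]
      push_cast
      rfl
    refine this.trans (congrArg _ ?_)
    rw [← b.sum_sq_norm_inner_right]
    refine Finset.sum_congr rfl fun k _ => ?_
    rw [ContinuousLinearMap.adjoint_inner_right, norm_inner_symm]
  rw [hsNorm, h, Complex.ofReal_re, Real.sq_sqrt]
  positivity

theorem dim_mul_hsNorm_sq_eq_sum (x : UnitaryDual G) :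
    (x.rep.dim : ℝ) * hsNorm (measureFourier μ x.rep) ^ 2 =
      ∑ p, ‖fourierCoef m μ ⟨x, p⟩‖ ^ 2 := by
  rw [hsNorm_sq (x.rep.onb m), Fintype.sum_prod_type_right, Finset.mul_sum]
  refine Finset.sum_congr rfl fun i _ => ?_
  rw [Finset.mul_sum]
  refine Finset.sum_congr rfl fun k _ => ?_
  rw [fourierCoef_eq, norm_mul, mul_pow, Complex.norm_real, Real.norm_eq_abs, sq_abs,
    Real.sq_sqrt (Nat.cast_nonneg _)]

theorem summable_dim_mul_hsNorm_sq_iff :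
    (Summable fun x : UnitaryDual G => (x.rep.dim : ℝ) * hsNorm (measureFourier μ x.rep) ^ 2) ↔
      Summable fun p : DualIndex G => ‖fourierCoef m μ p‖ ^ 2 := by
  rw [summable_sigma_of_nonneg fun p => by positivity]
  simp only [tsum_fintype, dim_mul_hsNorm_sq_eq_sum m]
  exact ⟨fun h => ⟨fun x => (hasSum_fintype _).summable, h⟩, fun h => h.2⟩

/-- The summand of the Fourier series, as a continuous function. -/
noncomputable def fourierTerm (x : UnitaryDual G) : C(G, ℂ) :=
  ∑ p, fourierCoef m μ ⟨x, p⟩ • normCoef m ⟨x, p⟩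

theorem fourierTerm_apply (x : UnitaryDual G) (σ : G) : fourierTerm m μ x σ =
    (x.rep.dim : ℂ) * opTrace (measureFourier μ x.rep ∘L x.rep.op σ) := by
  rw [dim_mul_opTrace_eq_sum m, fourierTerm, ContinuousMap.sum_apply]
  rfl

/-- The unconditional basis expansion may be grouped into the finite blocks of the classes. -/
theorem hasSum_fourierTerm {f : Lp ℂ 2 m}
    (hf : ∀ p, ⟪ContinuousMap.toLp 2 m ℂ (normCoef m p), f⟫_ℂ = fourierCoef m μ p) :
    HasSum (fun x => ContinuousMap.toLp 2 m ℂ (fourierTerm m μ x)) f := by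
  refine ((coefBasis m).hasSum_repr f).sigma fun x => ?_
  simp only [HilbertBasis.repr_apply_apply, coefBasis_apply, hf, fourierTerm, map_sum, map_smul]
  exact hasSum_fintype _

theorem hasL2Sum_of_hasSum {ι : Type*} {F : ι → C(G, ℂ)} {g : G → ℂ} (hg : MemLp g 2 m)
    (h : HasSum (fun i => ContinuousMap.toLp 2 m ℂ (F i)) (hg.toLp g)) :
    HasL2Sum m (fun i σ => F i σ) g := by
  refine ⟨fun i => (F i).memLp m ℂ, hg, ?_⟩
  have h1 : Tendsto (fun s : Finset ι => ‖hg.toLp g - ∑ i ∈ s, ContinuousMap.toLp 2 m ℂ (F i)‖ₑ)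
      atTop (𝓝 0) := by
    have := (tendsto_const_nhds (x := hg.toLp g)).sub h
    rw [sub_self] at this
    simpa using this.enorm
  refine h1.congr fun s => ?_
  rw [← map_sum]
  have h2 : hg.toLp g - ContinuousMap.toLp 2 m ℂ (∑ i ∈ s, F i) =
      (hg.sub ((∑ i ∈ s, F i).memLp m ℂ)).toLp _ := rfl
  rw [h2, Lp.enorm_toLp]
  congr 1
  ext σ
  simp

end FourierTransform

/-! ### Densities of finite measures -/

section Density

theorem IsL2Density.integrable {X : Type*} [MeasurableSpace X] {μ m : Measure X} {f : X → ℝ}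
    (hf : IsL2Density μ m f) : Integrable f m :=
  hf.1

theorem IsL2Density.memLp_ofReal {X : Type*} [MeasurableSpace X] {μ m : Measure X} {f : X → ℝ}
    (hf : IsL2Density μ m f) : MemLp (fun x => (f x : ℂ)) 2 m :=
  MemLp.ofReal (K := ℂ) hf.2.1

theorem IsL2Density.measureReal_eq {X : Type*} [MeasurableSpace X] {μ m : Measure X} {f : X → ℝ}
    (hf : IsL2Density μ m f) {A : Set X} (hA : MeasurableSet A) : μ.real A = ∫ x in A, f x ∂m :=
  hf.2.2 A hA

theorem IsL2Density.nonneg {X : Type*} [MeasurableSpace X] {μ m : Measure X} {f : X → ℝ}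
    (hf : IsL2Density μ m f) : 0 ≤ᵐ[m] f := by
  refine ae_nonneg_of_forall_setIntegral_nonneg hf.integrable fun s hs _ => ?_
  rw [← hf.measureReal_eq hs]
  exact measureReal_nonneg

theorem IsL2Density.eq_withDensity {X : Type*} [MeasurableSpace X] {μ m : Measure X}
    [IsFiniteMeasure μ] {f : X → ℝ} (hf : IsL2Density μ m f) :
    μ = m.withDensity fun x => ENNReal.ofReal (f x) := by
  ext A hA
  rw [withDensity_apply _ hA, ← ofReal_integral_eq_lintegral_ofReal hf.integrable.integrableOn
    (ae_restrict_of_ae hf.nonneg), ← hf.measureReal_eq hA, ofReal_measureReal]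

theorem IsL2Density.integral_eq {X : Type*} [MeasurableSpace X] {μ m : Measure X}
    [IsFiniteMeasure μ] {f : X → ℝ} (hf : IsL2Density μ m f) (h : X → ℂ) :
    ∫ x, h x ∂μ = ∫ x, (f x : ℂ) * h x ∂m := by
  rw [hf.eq_withDensity, integral_withDensity_eq_integral_toReal_smul₀
    hf.integrable.aestronglyMeasurable.aemeasurable.ennreal_ofReal
    (.of_forall fun _ => ENNReal.ofReal_lt_top)]
  refine integral_congr_ae ?_
  filter_upwards [hf.nonneg] with x hx
  rw [ENNReal.toReal_ofReal hx, Complex.real_smul]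

/-- A finite measure is determined to have an integrable density by integrals of bounded continuous
functions. -/
theorem measureReal_eq_setIntegral_of_forall_integral_eq {X : Type*} [TopologicalSpace X]
    [HasOuterApproxClosed X] [MeasurableSpace X] [BorelSpace X] {μ m : Measure X}
    [IsFiniteMeasure μ] {f : X → ℝ} (hf : Integrable f m)
    (h : ∀ φ : BoundedContinuousFunction X ℝ, ∫ x, φ x ∂μ = ∫ x, f x * φ x ∂m) {A : Set X}
    (hA : MeasurableSet A) : μ.real A = ∫ x in A, f x ∂m := by
  have hpos : ∀ g : X → ℝ, Integrable g m → ∀ φ : BoundedContinuousFunction X ℝ,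
      ∫ x, φ x ∂(m.withDensity fun x => ENNReal.ofReal (g x)) = ∫ x, max (g x) 0 * φ x ∂m := by
    intro g hg φ
    rw [integral_withDensity_eq_integral_toReal_smul₀
      hg.aestronglyMeasurable.aemeasurable.ennreal_ofReal
      (.of_forall fun _ => ENNReal.ofReal_lt_top)]
    rfl
  have hint : ∀ g : X → ℝ, Integrable g m → ∀ φ : BoundedContinuousFunction X ℝ,
      Integrable (fun x => g x * φ x) m := by
    intro g hg φ
    exact hg.mul_bdd (c := ‖φ‖) φ.continuous.aestronglyMeasurable
      (.of_forall fun x => φ.norm_coe_le_norm x)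
  have hfin₁ := isFiniteMeasure_withDensity_ofReal hf.2
  have hfin₂ := isFiniteMeasure_withDensity_ofReal hf.neg.2
  -- The sign of f is not yet known, so its negative part is moved to the left, giving two finite
  -- measures to compare on bounded continuous functions.
  have key : μ + m.withDensity (fun x => ENNReal.ofReal ((-f) x)) =
      m.withDensity fun x => ENNReal.ofReal (f x) := by
    refine ext_of_forall_integral_eq_of_IsFiniteMeasure fun φ => ?_
    rw [integral_add_measure (φ.integrable _) (φ.integrable _), h, hpos _ hf.neg, hpos _ hf,
      ← integral_add (hint _ hf φ) (hint _ hf.neg.pos_part φ)]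
    refine integral_congr_ae (.of_forall fun x => ?_)
    simp only [Pi.neg_apply]
    rw [← add_mul]
    congr 1
    rcases le_total 0 (f x) with hx | hx
    · rw [max_eq_right (by linarith), max_eq_left hx, add_zero]
    · rw [max_eq_left (by linarith), max_eq_right hx, add_neg_cancel]
  have hreal : ∀ g : X → ℝ, Integrable g m →
      (m.withDensity fun x => ENNReal.ofReal (g x)).real A = ∫ x in A, max (g x) 0 ∂m := by
    intro g hg
    rw [measureReal_def, withDensity_apply _ hA, ← integral_toReal
      hg.aestronglyMeasurable.aemeasurable.ennreal_ofReal.restrict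
      (.of_forall fun _ => ENNReal.ofReal_lt_top)]
    rfl
  have h1 : (μ + m.withDensity (fun x => ENNReal.ofReal ((-f) x))).real A =
      (m.withDensity fun x => ENNReal.ofReal (f x)).real A := by rw [key]
  rw [measureReal_add_apply, hreal _ hf.neg, hreal _ hf] at h1
  rw [eq_sub_of_add_eq h1, ← integral_sub hf.pos_part.integrableOn hf.neg.pos_part.integrableOn]
  refine integral_congr_ae (.of_forall fun x => ?_)
  simp only [Pi.neg_apply]
  rcases le_total 0 (f x) with hx | hx
  · rw [max_eq_left hx, max_eq_right (by linarith), sub_zero]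
  · rw [max_eq_right hx, max_eq_left (by linarith), zero_sub, neg_neg]

end Density

/-! ### The L² criterion and the Fourier series -/

section Characterisation

variable {G : Type*} [Group G] [TopologicalSpace G]
  [IsTopologicalGroup G] [CompactSpace G] [T2Space G] [SecondCountableTopology G]
  [MeasurableSpace G] [BorelSpace G] {m : Measure G} [m.IsHaarMeasure] [IsProbabilityMeasure m]
  {μ : Measure G} [IsFiniteMeasure μ]

theorem IsL2Density.inner_normCoef {f : G → ℝ} (hf : IsL2Density μ m f) (p : DualIndex G) :
    ⟪ContinuousMap.toLp 2 m ℂ (normCoef m p), hf.memLp_ofReal.toLp _⟫_ℂ =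
      fourierCoef m μ p := by
  rw [fourierCoef, hf.integral_eq, L2.inner_def]
  refine integral_congr_ae ?_
  filter_upwards [ContinuousMap.coeFn_toLp (p := 2) (𝕜 := ℂ) m (normCoef m p),
    hf.memLp_ofReal.coeFn_toLp] with x h1 h2
  rw [h1, h2]
  simp

/-- Integration against a finite measure as a continuous functional. -/
noncomputable def integralFunctional (μ : Measure G) [IsFiniteMeasure μ] : C(G, ℂ) →L[ℂ] ℂ :=
  LinearMap.mkContinuous
    { toFun := fun φ => ∫ x, φ x ∂μ
      map_add' := fun φ ψ => integral_add (φ.continuous.integrable_of_compactSpace μ)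
        (ψ.continuous.integrable_of_compactSpace μ)
      map_smul' := fun c φ => integral_const_mul c _ } (μ.real Set.univ) (by
    intro φ
    rw [mul_comm]
    exact norm_integral_le_of_norm_le_const (.of_forall fun x => φ.norm_coe_le_norm x))

theorem inner_toLp_eq_integral {g : Lp ℂ 2 m}
    (hg : ∀ p, ⟪ContinuousMap.toLp 2 m ℂ (normCoef m p), g⟫_ℂ = fourierCoef m μ p)
    (φ : C(G, ℂ)) : ⟪g, ContinuousMap.toLp 2 m ℂ φ⟫_ℂ = ∫ x, φ x ∂μ := by
  let A : C(G, ℂ) →L[ℂ] ℂ := (innerSL ℂ g) ∘L (ContinuousMap.toLp 2 m ℂ)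
  have h := eq_top_of_forall_normCoef_mem m (A - integralFunctional μ).ker
    (A - integralFunctional μ).isClosed_ker (fun p => by
      rw [LinearMap.mem_ker]
      change ⟪g, ContinuousMap.toLp 2 m ℂ (normCoef m p)⟫_ℂ - ∫ x, normCoef m p x ∂μ = 0
      rw [sub_eq_zero, ← inner_conj_symm, hg, fourierCoef, ← integral_conj]
      simp)
  have hφ : φ ∈ (A - integralFunctional μ).ker := h ▸ Submodule.mem_top
  rw [LinearMap.mem_ker] at hφ
  exact sub_eq_zero.1 hφ

/-- g is not known to be real, but real test functions determine a measure and see only Re g. -/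
theorem isL2Density_of_inner_normCoef {g : Lp ℂ 2 m}
    (hg : ∀ p, ⟪ContinuousMap.toLp 2 m ℂ (normCoef m p), g⟫_ℂ = fourierCoef m μ p) :
    IsL2Density μ m fun x => (g x).re := by
  have hmem : MemLp (fun x => (g x).re) 2 m := (Lp.memLp g).re
  have hint : Integrable (fun x => (g x).re) m := hmem.integrable (by norm_num)
  refine ⟨hint, hmem, fun A hA =>
    measureReal_eq_setIntegral_of_forall_integral_eq hint (fun φ => ?_) hA⟩
  let ψ : C(G, ℂ) := ⟨fun x => (φ x : ℂ), by fun_prop⟩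
  have h1 := inner_toLp_eq_integral hg ψ
  have h2 : Integrable (fun x => ⟪g x, (ContinuousMap.toLp 2 m ℂ ψ : Lp ℂ 2 m) x⟫_ℂ) m :=
    L2.integrable_inner _ _
  rw [L2.inner_def] at h1
  have h3 := congrArg Complex.re h1
  rw [show ∫ x, ψ x ∂μ = ((∫ x, φ x ∂μ : ℝ) : ℂ) from integral_ofReal, Complex.ofReal_re,
    ← show _ = (∫ x, ⟪g x, (ContinuousMap.toLp 2 m ℂ ψ : Lp ℂ 2 m) x⟫_ℂ ∂m).re from
      integral_re h2] at h3
  rw [← h3]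
  refine integral_congr_ae ?_
  filter_upwards [ContinuousMap.coeFn_toLp (p := 2) (𝕜 := ℂ) m ψ] with x hx
  rw [hx]
  simp [ψ, mul_comm]

/-- Bessel's inequality in one direction, Riesz-Fischer in the other. -/
theorem exists_isL2Density_iff_summable : (∃ f : G → ℝ, IsL2Density μ m f) ↔
    Summable fun x : UnitaryDual G => (x.rep.dim : ℝ) * hsNorm (measureFourier μ x.rep) ^ 2 := by
  rw [summable_dim_mul_hsNorm_sq_iff m]
  constructor
  · rintro ⟨f, hf⟩
    have := (orthonormal_normCoef m).inner_products_summable (hf.memLp_ofReal.toLp _)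
    simpa only [hf.inner_normCoef] using this
  · intro h
    have hmem : Memℓp (fourierCoef m μ) 2 := memℓp_gen (by simpa using h)
    refine ⟨_, isL2Density_of_inner_normCoef (g := (coefBasis m).repr.symm ⟨_, hmem⟩) fun p => ?_⟩
    rw [← coefBasis_apply, ← HilbertBasis.repr_apply_apply, LinearIsometryEquiv.apply_symm_apply]

theorem IsL2Density.hasL2Sum {f : G → ℝ} (hf : IsL2Density μ m f) :
    HasL2Sum m (fun (x : UnitaryDual G) (σ : G) =>
      (x.rep.dim : ℂ) * opTrace (measureFourier μ x.rep ∘L x.rep.op σ)) fun σ => (f σ : ℂ) := by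
  simp only [← fourierTerm_apply m μ]
  exact hasL2Sum_of_hasSum m hf.memLp_ofReal (hasSum_fourierTerm m μ hf.inner_normCoef)

end Characterisation

theorem theorem3p1 {d : ℕ} {G : Type*} [Group G] [TopologicalSpace G]
    [ChartedSpace (EuclideanSpace ℝ (Fin d)) G] [LieGroup (𝓡 d) ∞ G]
    [T2Space G] [CompactSpace G] [ConnectedSpace G] [MeasurableSpace G] [BorelSpace G]
    (m : Measure G) [m.IsHaarMeasure] [IsProbabilityMeasure m]
    (μ : Measure G) [IsProbabilityMeasure μ] :
    ((∃ f : G → ℝ, IsL2Density μ m f) ↔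
      Summable fun x : UnitaryDual G =>
        (x.rep.dim : ℝ) * hsNorm (measureFourier μ x.rep) ^ 2) ∧
    ∀ f : G → ℝ, IsL2Density μ m f →
      ∃ g : G → ℂ,
        HasL2Sum m
          (fun (x : UnitaryDual G) (σ : G) =>
            (x.rep.dim : ℂ) * opTrace (measureFourier μ x.rep ∘L x.rep.op σ)) g ∧
        ∀ᵐ σ ∂m, (f σ : ℂ) = g σ := by
  have := topologicalGroup_of_lieGroup (𝓡 d) ∞ (G := G)
  -- Second countability makes continuous functions into arbitrary normed spaces strongly
  -- measurable, as the vector-valued integrals require.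
  have := ChartedSpace.secondCountable_of_sigmaCompact (EuclideanSpace ℝ (Fin d)) G
  exact ⟨exists_isL2Density_iff_summable, fun f hf => ⟨_, hf.hasL2Sum, .of_forall fun _ => rfl⟩⟩
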